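/- Let $d\ge 1$ be an integer, let $\mathbb T^d=\mathbb R^d/\mathbb Z^d$ with its Haar probability measure $\mu$, and for $0<s<1/2$ let $Q(s)=[-s,s)^d+\mathbb Z^d\subset\mathbb T^d$ be the periodized cube of center $0$ and edge $2s$. For a finite sequence $\mathcal P_N=\{p_n\}_{n=1}^N$ in $\mathbb T^d$ and a measurable set $A\subset\mathbb T^d$ let \[ \mathscr D(A,\mathcal P_N)=\sum_{n=1}^N\chi_A(p_n)-N\mu(A), \] so that $\mathscr D(x+Q(s),\mathcal P_N)=\sum_{n=1}^N\chi_{x+Q(s)}(p_n)-N(2s)^d$. For an even positive integer $M$ set \[ \mathbb J_M=\Big\{j\in\mathbb Z:-\frac M2\le j<\frac M2\Big\},\qquad \mathbb S_M=\Big\{\frac1M,\frac2M,\ldots,\frac12-\frac1M\Big\}. \] Then there exists a constant $c>0$, depending only on $d$, such that for every positive integer $N$, for every even integer $M\ge 18dN$ and for every finite sequence $\mathcal P_N=\{p_n\}_{n=1}^N$ in $\mathbb T^d$, \[ \left(\frac1{(\operatorname{card}\mathbb J_M)^d}\,\frac1{\operatorname{card}\mathbb S_M}\sum_{j_1,\ldots,j_d\in\mathbb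 J_M}\ \sum_{s\in\mathbb S_M}\left|\mathscr D\left(\Big(\frac{j_1}M,\ldots,\frac{j_d}M\Big)+Q(s),\mathcal P_N\right)\right|^2\right)^{1/2}\ \ge\ c\,(\log N)^{\frac{d-1}2}, \] where for $d=1$ the right-hand side is $c$. -/

import Mathlib

open MeasureTheory

noncomputable section

/-- The `d`-dimensional torus `ℝ^d / ℤ^d`, with its Haar probability measure `volume`. -/
abbrev Torus (d : ℕ) : Type := Fin d → UnitAddCircle

/-- The projection `ℝ^d → ℝ^d / ℤ^d`. -/
def Torus.proj {d : ℕ} (x : Fin d → ℝ) : Torus d := fun i => (x i : UnitAddCircle)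

/-- The discrepancy `∑ₙ χ_A(pₙ) - N μ(A)` of a finite sequence of points in the torus with respect
to a set `A`, where `μ` is the Haar probability measure. -/
def discrepancy {d N : ℕ} (A : Set (Torus d)) (p : Fin N → Torus d) : ℝ :=
  (∑ n : Fin N, A.indicator (fun _ => (1 : ℝ)) (p n)) - (N : ℝ) * (volume : Measure (Torus d)).real A

/-- The periodized cube `Q(s) = [-s, s)^d + ℤ^d`, as a subset of the torus. -/
def torusCube (d : ℕ) (s : ℝ) : Set (Torus d) :=
  Torus.proj '' {y : Fin d → ℝ | ∀ i, -s ≤ y i ∧ y i < s}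

/-- The translate `x + Q(s)` of the periodized cube. -/
def translatedCube {d : ℕ} (x : Torus d) (s : ℝ) : Set (Torus d) :=
  (fun y => x + y) '' torusCube d s

/-- `𝕁_M = {j ∈ ℤ : -M/2 ≤ j < M/2}`. -/
def gridIndices (M : ℕ) : Finset ℤ :=
  (Finset.Icc (-(M : ℤ)) (M : ℤ)).filter (fun j => -(M : ℤ) ≤ 2 * j ∧ 2 * j < (M : ℤ))

/-- `𝕊_M = {1/M, 2/M, …, 1/2 - 1/M}` (for `M` even). -/
def gridRadii (M : ℕ) : Finset ℝ :=
  (Finset.Icc 1 (M / 2 - 1)).image (fun r : ℕ => (r : ℝ) / (M : ℝ))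

end

/-!
Write `M = 2H`. A cube with center on the grid `(1/M)ℤ^d` and radius `r/M` contains a point `x` of the
torus exactly when a congruence condition on the integer parts `⌊M xᵢ⌋` holds, so the problem lives on
the finite group `(ℤ/M)^d`. There the Fourier coefficient of the discrepancy at a nonzero frequency `k`
is `S(k) ∏ A_r(kᵢ)`, with `S` the exponential sum of the points (`pointSum`) and `A_r` the Dirichlet
kernel (`arcSum`); see `sum_discrepancy_mul_conj_gridChar`. By Bessel's inequality the mean square over
the centers is at least the contribution of the frequencies with `|kᵢ| ≲ N`.

The kernel satisfies `|A_r(k)| ≥ H / (π k') · |1 - exp (2πi k' r / H)|` with `k' = max(1, |k|)`, and it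
vanishes for some radii. Averaging over `r` repairs this: `|1 - z|` dominates `1` minus a normalized
Fejér kernel, whose mean over `r` is less than `1 / (2d)` as soon as `2d k' < H`, so that the mean of
the product of the `d` factors is bounded below (`le_sum_prod_norm_one_sub_unitExp`). This is what the
hypothesis `M ≥ 18dN` is for, besides keeping the frequencies distinct modulo `M`.

It remains to bound `∑ |S(k)|² ∏ max(1, |kᵢ|)⁻²` below by a multiple of `(log N)^(d-1)`. On each box
`|kᵢ| < 2 ^ aᵢ` with `2 ^ (∑ aᵢ)` between `2N` and `4N`, the sum of `|S(k)|²` over `k ≠ 0` is at least a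
multiple of `N²` (`le_sum_norm_pointSum_sq`). There are about `(log N)^(d-1)` such boxes, and they
overlap so little, relative to the weights, that their contributions add up
(`sum_dyadicShapes_ite_le`, `card_dyadicShapes_le`).
-/

/-! ### The additive character `x ↦ exp (2πix)` -/

/-- The character `x ↦ exp (2πix)` of `ℝ`, as a complex number. -/
noncomputable def unitExp (x : ℝ) : ℂ := Complex.exp (Complex.I * ((2 * Real.pi * x : ℝ) : ℂ))

lemma unitExp_add (x y : ℝ) : unitExp (x + y) = unitExp x * unitExp y := by
  unfold unitExp
  rw [← Complex.exp_add]
  congr 1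
  push_cast
  ring

lemma unitExp_zero : unitExp 0 = 1 := by simp [unitExp]

lemma unitExp_neg (x : ℝ) : unitExp (-x) = (starRingEnd ℂ) (unitExp x) := by
  unfold unitExp
  rw [← Complex.exp_conj]
  congr 1
  simp only [map_mul, Complex.conj_I, Complex.conj_ofReal]
  push_cast
  ring

lemma norm_unitExp (x : ℝ) : ‖unitExp x‖ = 1 := by
  unfold unitExp
  rw [mul_comm]
  exact Complex.norm_exp_ofReal_mul_I _

lemma unitExp_sub (x y : ℝ) : unitExp (x - y) = unitExp x * (starRingEnd ℂ) (unitExp y) := by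
  rw [sub_eq_add_neg, unitExp_add, unitExp_neg]

lemma unitExp_eq_one_iff (x : ℝ) : unitExp x = 1 ↔ ∃ n : ℤ, x = n := by
  unfold unitExp
  rw [Complex.exp_eq_one_iff]
  refine exists_congr fun n => ?_
  have h : (2 * (Real.pi : ℂ) * Complex.I) ≠ 0 := by simp [Real.pi_ne_zero]
  have e : Complex.I * ((2 * Real.pi * x : ℝ) : ℂ) = (x : ℂ) * (2 * Real.pi * Complex.I) := by
    push_cast
    ring
  rw [e, mul_left_inj' h]
  norm_cast

lemma unitExp_intCast (n : ℤ) : unitExp n = 1 := (unitExp_eq_one_iff _).2 ⟨n, rfl⟩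

lemma unitExp_nat_mul (n : ℕ) (x : ℝ) : unitExp (n * x) = unitExp x ^ n := by
  unfold unitExp
  rw [← Complex.exp_nat_mul]
  congr 1
  push_cast
  ring

lemma norm_one_sub_unitExp_le (x : ℝ) : ‖1 - unitExp x‖ ≤ 2 * Real.pi * |x| := by
  rw [norm_sub_rev]
  refine Real.norm_exp_I_mul_ofReal_sub_one_le.trans_eq ?_
  rw [Real.norm_eq_abs, abs_mul, abs_of_pos Real.two_pi_pos]

lemma norm_one_sub_unitExp_neg (x : ℝ) : ‖1 - unitExp (-x)‖ = ‖1 - unitExp x‖ := by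
  rw [unitExp_neg, ← RCLike.norm_conj (1 - unitExp x)]
  simp

/-- Orthogonality of the characters of the cyclic group of order `n`. -/
lemma sum_range_unitExp {n : ℕ} (hn : 0 < n) (k : ℤ) :
    ∑ r ∈ Finset.range n, unitExp (k * r / n) = if (n : ℤ) ∣ k then (n : ℂ) else 0 := by
  have hn' : (n : ℝ) ≠ 0 := by positivity
  have e : ∀ r : ℕ, unitExp (k * r / n) = unitExp (k / n) ^ r := fun r => by
    rw [← unitExp_nat_mul]
    congr 1
    ring
  simp_rw [e]
  have h1 : unitExp (k / n) = 1 ↔ (n : ℤ) ∣ k := by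
    rw [unitExp_eq_one_iff]
    refine exists_congr fun m => ?_
    rw [div_eq_iff hn', mul_comm]
    exact_mod_cast Iff.rfl
  split_ifs with h
  · simp [h1.2 h]
  · rw [geom_sum_eq (mt h1.1 h), ← unitExp_nat_mul, mul_div_cancel₀ _ hn', unitExp_intCast]
    simp

/-! ### The grid -/

lemma gridIndices_eq_Ico (H : ℕ) : gridIndices (2 * H) = Finset.Ico (-(H : ℤ)) H := by
  ext j
  simp only [gridIndices, Finset.mem_filter, Finset.mem_Icc, Finset.mem_Ico]
  push_cast
  omega

lemma card_gridIndices (H : ℕ) : (gridIndices (2 * H)).card = 2 * H := by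
  rw [gridIndices_eq_Ico, Int.card_Ico]
  omega

lemma gridRadii_eq_image (H : ℕ) :
    gridRadii (2 * H) =
      (Finset.Ico 1 H).image (fun r : ℕ => (r : ℝ) / ((2 * H : ℕ) : ℝ)) := by
  unfold gridRadii
  congr 1
  ext r
  simp only [Finset.mem_Icc, Finset.mem_Ico]
  omega

lemma injective_div_natCast {H : ℕ} (hH : 0 < H) :
    Function.Injective (fun r : ℕ => (r : ℝ) / ((2 * H : ℕ) : ℝ)) := by
  intro a b h
  have : ((2 * H : ℕ) : ℝ) ≠ 0 := by positivity
  exact_mod_cast (div_left_inj' this).1 h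

lemma sum_gridIndices_unitExp {H : ℕ} (hH : 0 < H) (k : ℤ) :
    ∑ j ∈ gridIndices (2 * H), unitExp (k * j / (2 * H : ℕ)) =
      if ((2 * H : ℕ) : ℤ) ∣ k then ((2 * H : ℕ) : ℂ) else 0 := by
  have hM : ((2 * H : ℕ) : ℝ) ≠ 0 := by positivity
  have e : ∑ j ∈ gridIndices (2 * H), unitExp (k * j / (2 * H : ℕ)) =
      unitExp (k * (-(H : ℤ) : ℤ) / (2 * H : ℕ)) *
        ∑ r ∈ Finset.range (2 * H), unitExp (k * r / (2 * H : ℕ)) := by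
    rw [Finset.mul_sum, gridIndices_eq_Ico]
    refine Finset.sum_nbij' (fun j => (j + H).toNat) (fun r => (r : ℤ) - H) ?_ ?_ ?_ ?_ ?_
    · intro j hj
      simp only [Finset.mem_Ico, Finset.mem_range] at *
      omega
    · intro j hj
      simp only [Finset.mem_Ico, Finset.mem_range] at *
      omega
    · intro j hj
      simp only [Finset.mem_Ico] at *
      omega
    · intro j hj
      simp
    · intro j hj
      rw [← unitExp_add]
      congr 1
      have : (((j + H).toNat : ℤ) : ℝ) = ((j + H : ℤ) : ℝ) := by
        rw [Int.toNat_of_nonneg]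
        simp only [Finset.mem_Ico] at hj
        omega
      rw [← Int.cast_natCast (j + H).toNat, this]
      push_cast
      ring
  rw [e, sum_range_unitExp (by omega)]
  split_ifs with h
  · obtain ⟨m, rfl⟩ := h
    have : (((2 * H : ℕ) : ℤ) * m : ℤ) * ((-(H : ℤ) : ℤ) : ℝ) / (2 * H : ℕ) = (-(m * H) : ℤ) := by
      push_cast at hM ⊢
      field_simp
    rw [this, unitExp_intCast, one_mul]
  · simp

open Classical in
/-- The sum of a `2H`-periodic function over the residues `j` whose arc `[j - r, j + r)` modulo
`2H` contains `q`. The bound `r < H` keeps the arc from overlapping itself. -/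
lemma sum_gridIndices_arc {H r : ℕ} (hr : r < H) (q : ℤ) (ψ : ℤ → ℂ)
    (hψ : ∀ j m : ℤ, ψ (j + (2 * H : ℕ) * m) = ψ j) :
    ∑ j ∈ (gridIndices (2 * H)).filter
        (fun j => ∃ m : ℤ, -(r : ℤ) ≤ q - j + (2 * H : ℕ) * m ∧ q - j + (2 * H : ℕ) * m < r), ψ j =
      ∑ u ∈ Finset.Ico (-(r : ℤ)) r, ψ (q - u) := by
  symm
  rw [gridIndices_eq_Ico]
  set M : ℤ := ((2 * H : ℕ) : ℤ) with hMdef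
  have hM : 0 < M := by omega
  have key : ∀ u : ℤ, (q - u + H) % M - H = q - u + M * (-((q - u + H) / M)) := fun u => by
    have := Int.emod_add_mul_ediv (q - u + H) M
    linarith
  refine Finset.sum_nbij (fun u => (q - u + H) % M - H) ?_ ?_ ?_ ?_
  · intro u hu
    have h1 := Int.emod_nonneg (q - u + H) hM.ne'
    have h2 := Int.emod_lt_of_pos (q - u + H) hM
    simp only [Finset.mem_filter, Finset.mem_Ico] at *
    refine ⟨by omega, -((q - u + H) / M), ?_⟩
    rw [key]
    constructor <;> linarith
  · intro u hu v hv h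
    simp only [Finset.coe_Ico, Set.mem_Ico] at *
    have h' : (q - u + H) % M = (q - v + H) % M := by linarith
    have h3 : M ∣ (v - u) := by
      have := Int.emod_emod_of_dvd (q - u + H) (dvd_refl M)
      have h4 := Int.ModEq.dvd (show (q - v + H) ≡ (q - u + H) [ZMOD M] from h'.symm)
      convert h4 using 1
      ring
    obtain ⟨c, hc⟩ := h3
    have : c = 0 := by
      rcases lt_trichotomy c 0 with h | h | h
      · have : M * c ≤ M * (-1) := by gcongr; omega
        omega
      · exact h
      · have : M * 1 ≤ M * c := by gcongr; omega
        omega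
    subst this
    omega
  · intro j hj
    simp only [Finset.coe_filter, Finset.mem_Ico, Set.mem_ofPred_eq] at hj
    obtain ⟨hj, m, hm⟩ := hj
    refine ⟨q - j + M * m, by simpa using hm, ?_⟩
    have : q - (q - j + M * m) + H = (j + H) + M * (-m) := by ring
    simp only [this, Int.add_mul_emod_self_left]
    rw [Int.emod_eq_of_lt (by omega) (by omega)]
    ring
  · intro u _
    simp only [key]
    rw [hψ]

/-! ### Cubes and the grid -/

/-- A point lies in a grid-aligned cube exactly when the cell of the grid that contains it does, and
this is a congruence condition on the integer parts `⌊M xᵢ⌋`. -/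
lemma proj_mem_translatedCube_iff {d M : ℕ} (hM : 0 < M) (x : Fin d → ℝ) (j : Fin d → ℤ) (r : ℕ) :
    Torus.proj x ∈ translatedCube (Torus.proj (fun i => (j i : ℝ) / (M : ℝ))) ((r : ℝ) / M) ↔
      ∀ i, ∃ m : ℤ, -(r : ℤ) ≤ ⌊(M : ℝ) * x i⌋ - j i + (M : ℕ) * m ∧
        ⌊(M : ℝ) * x i⌋ - j i + (M : ℕ) * m < r := by
  have hM' : (0 : ℝ) < M := by exact_mod_cast hM
  have cell : ∀ (z : ℝ) (a : ℤ), (-((r : ℝ) / M) ≤ z / M + a / M ∧ z / M + a / M < (r : ℝ) / M) ↔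
      (-(r : ℤ) ≤ ⌊z⌋ + a ∧ ⌊z⌋ + a < r) := by
    intro z a
    rw [← add_div, ← neg_div, div_le_div_iff_of_pos_right hM', div_lt_div_iff_of_pos_right hM',
      ← Int.floor_add_intCast, Int.le_floor, Int.floor_lt]
    push_cast
    rfl
  constructor
  · rintro ⟨_, ⟨y, hy, rfl⟩, h⟩ i
    have hi : (((j i : ℝ) / M + y i : ℝ) : UnitAddCircle) = (x i : UnitAddCircle) := by
      have := congrFun h i
      simpa [Torus.proj] using this
    rw [← sub_eq_zero, ← AddCircle.coe_sub, AddCircle.coe_eq_zero_iff] at hi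
    obtain ⟨n, hn⟩ := hi
    refine ⟨n, ?_⟩
    have e : y i = (M * x i) / M + ((-j i + M * n : ℤ) : ℝ) / M := by
      rw [zsmul_eq_mul, mul_one] at hn
      push_cast
      rw [hn]
      field_simp
      ring
    have := hy i
    rw [e, cell] at this
    constructor <;> linarith [this.1, this.2]
  · intro h
    choose m hm using h
    have e : ∀ i, ⌊(M : ℝ) * x i⌋ - j i + M * m i = ⌊(M : ℝ) * x i⌋ + (-j i + M * m i) :=
      fun i => by ring
    simp_rw [e, ← cell] at hm
    refine ⟨_, ⟨_, hm, rfl⟩, ?_⟩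
    funext i
    simp only [Torus.proj, Pi.add_apply]
    rw [← AddCircle.coe_add, ← sub_eq_zero, ← AddCircle.coe_sub, AddCircle.coe_eq_zero_iff]
    refine ⟨m i, ?_⟩
    push_cast
    field_simp
    simp
    ring

lemma exists_proj_eq {d : ℕ} (p : Torus d) : ∃ x : Fin d → ℝ, Torus.proj x = p := by
  choose x hx using fun i => QuotientAddGroup.mk_surjective (p i)
  exact ⟨x, funext hx⟩

lemma volume_translatedCube {d : ℕ} (x : Torus d) (s : ℝ) :
    (volume : Measure (Torus d)).real (translatedCube x s) =
      (volume : Measure (Torus d)).real (torusCube d s) := by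
  unfold translatedCube
  rw [Measure.real, Measure.real, Set.image_add_left, measure_preimage_add]

/-! ### Fourier analysis on the grid -/

/-- The character `j ↦ exp (2πi k·j / M)` of the grid `(ℤ/M)^d`, on integer representatives. -/
noncomputable def gridChar {d : ℕ} (M : ℕ) (k j : Fin d → ℤ) : ℂ :=
  ∏ i, unitExp (k i * j i / M)

lemma gridChar_mul_conj {d : ℕ} (M : ℕ) (k l j : Fin d → ℤ) :
    gridChar M k j * (starRingEnd ℂ) (gridChar M l j) = gridChar M (k - l) j := by
  unfold gridChar
  rw [map_prod, ← Finset.prod_mul_distrib]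
  refine Finset.prod_congr rfl fun i _ => ?_
  rw [← unitExp_sub]
  congr 1
  push_cast [Pi.sub_apply]
  ring

lemma gridChar_sub {d : ℕ} (M : ℕ) (k a b : Fin d → ℤ) :
    gridChar M k (a - b) = gridChar M k a * (starRingEnd ℂ) (gridChar M k b) := by
  unfold gridChar
  rw [map_prod, ← Finset.prod_mul_distrib]
  refine Finset.prod_congr rfl fun i _ => ?_
  rw [← unitExp_sub]
  congr 1
  push_cast [Pi.sub_apply]
  ring

lemma sum_gridChar_eq_zero {d H : ℕ} (hH : 0 < H) (k : Fin d → ℤ)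
    (hk : ∃ i, ¬ ((2 * H : ℕ) : ℤ) ∣ k i) :
    ∑ j ∈ Fintype.piFinset (fun _ : Fin d => gridIndices (2 * H)), gridChar (2 * H) k j = 0 := by
  unfold gridChar
  rw [← Finset.prod_univ_sum (t := fun _ => gridIndices (2 * H))
    (f := fun i j => unitExp (k i * j / (2 * H : ℕ)))]
  obtain ⟨i, hi⟩ := hk
  refine Finset.prod_eq_zero (Finset.mem_univ i) ?_
  rw [sum_gridIndices_unitExp hH, if_neg hi]

/-- Bessel's inequality for a finite orthogonal family whose members have squared norm `W`. -/
lemma sum_norm_sq_le_of_orthogonal {ι κ : Type*} [DecidableEq κ] (G : Finset ι) (B : Finset κ)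
    (χ : κ → ι → ℂ) {W : ℝ} (hW : 0 < W)
    (hχ : ∀ k ∈ B, ∀ l ∈ B, ∑ j ∈ G, χ k j * (starRingEnd ℂ) (χ l j) = if k = l then (W : ℂ) else 0)
    (f : ι → ℂ) :
    ∑ k ∈ B, ‖∑ j ∈ G, f j * (starRingEnd ℂ) (χ k j)‖ ^ 2 ≤ W * ∑ j ∈ G, ‖f j‖ ^ 2 := by
  set c : κ → ℂ := fun k => ∑ j ∈ G, f j * (starRingEnd ℂ) (χ k j) with hc
  set g : ι → ℂ := fun j => ∑ k ∈ B, c k * χ k j with hg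
  set T : ℝ := ∑ k ∈ B, ‖c k‖ ^ 2 with hT
  have hTc : ∑ k ∈ B, c k * (starRingEnd ℂ) (c k) = T := by
    rw [hT]
    push_cast
    exact Finset.sum_congr rfl fun k _ => Complex.mul_conj' _
  have hfg : ∑ j ∈ G, f j * (starRingEnd ℂ) (g j) = T := by
    rw [← hTc]
    simp_rw [hg, map_sum, Finset.mul_sum, map_mul]
    rw [Finset.sum_comm]
    refine Finset.sum_congr rfl fun k _ => ?_
    simp only [hc, Finset.sum_mul]
    refine Finset.sum_congr rfl fun j _ => ?_
    ring
  have hgf : ∑ j ∈ G, g j * (starRingEnd ℂ) (f j) = T := by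
    have := congrArg (starRingEnd ℂ) hfg
    rw [map_sum, Complex.conj_ofReal] at this
    rw [← this]
    refine Finset.sum_congr rfl fun j _ => ?_
    rw [map_mul, Complex.conj_conj, mul_comm]
  have hgg : ∑ j ∈ G, g j * (starRingEnd ℂ) (g j) = W * T := by
    rw [← hTc, Finset.mul_sum]
    have e : ∀ j, g j * (starRingEnd ℂ) (g j) =
        ∑ k ∈ B, ∑ l ∈ B, c k * (starRingEnd ℂ) (c l) * (χ k j * (starRingEnd ℂ) (χ l j)) := by
      intro j
      simp_rw [hg, map_sum, Finset.sum_mul_sum, map_mul]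
      exact Finset.sum_congr rfl fun k _ => Finset.sum_congr rfl fun l _ => by ring
    simp_rw [e]
    rw [Finset.sum_comm]
    refine Finset.sum_congr rfl fun k hk => ?_
    rw [Finset.sum_comm]
    simp_rw [← Finset.mul_sum]
    rw [Finset.sum_congr rfl fun l hl => by rw [hχ k hk l hl]]
    simp only [mul_ite, mul_zero, Finset.sum_ite_eq, hk, if_true]
    ring
  have hff : ∑ j ∈ G, f j * (starRingEnd ℂ) (f j) = (∑ j ∈ G, ‖f j‖ ^ 2 : ℝ) := by
    push_cast
    exact Finset.sum_congr rfl fun k _ => Complex.mul_conj' _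
  have main : ((∑ j ∈ G, ‖W * f j - g j‖ ^ 2 : ℝ) : ℂ) =
      ((W ^ 2 * ∑ j ∈ G, ‖f j‖ ^ 2 - W * T : ℝ) : ℂ) := by
    have e : ((W ^ 2 * ∑ j ∈ G, ‖f j‖ ^ 2 - W * T : ℝ) : ℂ) =
        W ^ 2 * ∑ j ∈ G, f j * (starRingEnd ℂ) (f j) - W * ∑ j ∈ G, f j * (starRingEnd ℂ) (g j)
          - W * ∑ j ∈ G, g j * (starRingEnd ℂ) (f j) + ∑ j ∈ G, g j * (starRingEnd ℂ) (g j) := by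
      rw [hff, hfg, hgf, hgg]
      push_cast
      ring
    rw [e]
    push_cast
    simp_rw [Finset.mul_sum, ← Finset.sum_sub_distrib, ← Finset.sum_add_distrib]
    refine Finset.sum_congr rfl fun j _ => ?_
    rw [← Complex.mul_conj']
    simp only [map_sub, map_mul, Complex.conj_ofReal]
    ring
  have main' := Complex.ofReal_injective main
  have h0 : 0 ≤ W * (W * ∑ j ∈ G, ‖f j‖ ^ 2 - T) := by
    have : 0 ≤ ∑ j ∈ G, ‖W * f j - g j‖ ^ 2 := by positivity
    rw [main'] at this
    linarith
  have := nonneg_of_mul_nonneg_right h0 hW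
  linarith

/-- The Fourier coefficient at `κ` of the arc `[-r, r)` of the cyclic group of order `M`. -/
noncomputable def arcSum (M r : ℕ) (κ : ℤ) : ℂ :=
  ∑ u ∈ Finset.Ico (-(r : ℤ)) r, unitExp (κ * u / M)

/-- The exponential sum `∑ₙ exp (-2πi k·qₙ / M)` of a sequence of grid points. -/
noncomputable def pointSum {d N : ℕ} (M : ℕ) (q : Fin N → Fin d → ℤ) (k : Fin d → ℤ) : ℂ :=
  ∑ n, (starRingEnd ℂ) (gridChar M k (q n))

/-- The Fourier coefficients of the discrepancy at nonzero frequencies factor into those of the cube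
and the exponential sum of the points. The term `N μ(A)` does not depend on the center and
contributes to the zero frequency only. -/
lemma sum_discrepancy_mul_conj_gridChar {d N H r : ℕ} (hr : r < H) (x : Fin N → Fin d → ℝ)
    (k : Fin d → ℤ) (hk : ∃ i, ¬ ((2 * H : ℕ) : ℤ) ∣ k i) :
    ∑ j ∈ Fintype.piFinset (fun _ : Fin d => gridIndices (2 * H)),
      ((discrepancy (translatedCube (Torus.proj (fun i => (j i : ℝ) / (2 * H : ℕ)))
        ((r : ℝ) / (2 * H : ℕ))) (fun n => Torus.proj (x n)) : ℝ) : ℂ) *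
        (starRingEnd ℂ) (gridChar (2 * H) k j) =
      (∏ i, arcSum (2 * H) r (k i)) *
        pointSum (2 * H) (fun n i => ⌊((2 * H : ℕ) : ℝ) * x n i⌋) k := by
  classical
  have hH : 0 < H := by omega
  have hM : ((2 * H : ℕ) : ℝ) ≠ 0 := by positivity
  unfold discrepancy
  simp_rw [volume_translatedCube]
  push_cast [sub_mul, Finset.sum_sub_distrib]
  rw [← Finset.mul_sum, ← map_sum, sum_gridChar_eq_zero hH k hk, map_zero, mul_zero, sub_zero]
  simp_rw [Finset.sum_mul]
  rw [Finset.sum_comm]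
  unfold pointSum
  rw [Finset.mul_sum]
  refine Finset.sum_congr rfl fun n _ => ?_
  have e1 : ∀ j : Fin d → ℤ,
      ((Set.indicator (translatedCube (Torus.proj (fun i => (j i : ℝ) / (2 * H : ℕ)))
        ((r : ℝ) / (2 * H : ℕ))) (fun _ => (1 : ℝ)) (Torus.proj (x n)) : ℝ) : ℂ) *
        (starRingEnd ℂ) (gridChar (2 * H) k j) =
      ∏ i, if (∃ m : ℤ, -(r : ℤ) ≤ ⌊((2 * H : ℕ) : ℝ) * x n i⌋ - j i + (2 * H : ℕ) * m ∧
        ⌊((2 * H : ℕ) : ℝ) * x n i⌋ - j i + (2 * H : ℕ) * m < r) then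
          (starRingEnd ℂ) (unitExp (k i * j i / (2 * H : ℕ))) else 0 := by
    intro j
    rw [Set.indicator_apply, proj_mem_translatedCube_iff (by omega)]
    split_ifs with h
    · rw [Complex.ofReal_one, one_mul, gridChar, map_prod]
      exact Finset.prod_congr rfl fun i _ => by rw [if_pos (h i)]
    · rw [not_forall] at h
      obtain ⟨i, hi⟩ := h
      rw [Finset.prod_eq_zero (Finset.mem_univ i) (if_neg hi)]
      simp
  push_cast at e1 ⊢
  simp_rw [e1]
  rw [← Finset.prod_univ_sum (t := fun _ => gridIndices (2 * H))
    (f := fun i j => if (∃ m : ℤ, -(r : ℤ) ≤ ⌊(2 * (H : ℝ)) * x n i⌋ - j + (2 * H) * m ∧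
        ⌊(2 * (H : ℝ)) * x n i⌋ - j + (2 * H) * m < r) then
          (starRingEnd ℂ) (unitExp (k i * j / (2 * H))) else 0),
    gridChar, map_prod, ← Finset.prod_mul_distrib]
  refine Finset.prod_congr rfl fun i _ => ?_
  rw [← Finset.sum_filter]
  have := sum_gridIndices_arc hr ⌊(2 * (H : ℝ)) * x n i⌋
    (fun j => (starRingEnd ℂ) (unitExp (k i * j / (2 * H)))) (by
      intro j m
      rw [← unitExp_neg, ← unitExp_neg]
      have : -((k i : ℝ) * ((j + (2 * H : ℕ) * m : ℤ) : ℝ) / (2 * H)) =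
          -((k i : ℝ) * j / (2 * H)) + ((-(k i * m) : ℤ) : ℝ) := by
        push_cast at hM ⊢
        field_simp
        ring
      rw [this, unitExp_add, unitExp_intCast, mul_one])
  push_cast at this
  rw [this]
  unfold arcSum
  rw [Finset.sum_mul]
  refine Finset.sum_congr rfl fun u _ => ?_
  rw [← unitExp_neg, ← unitExp_neg, ← unitExp_add]
  congr 1
  push_cast
  ring

/-- The Dirichlet kernel estimate. Replacing the frequency `0` by `1` on the left makes the bound
uniform in the frequency. -/
lemma norm_one_sub_unitExp_le_arcSum {H : ℕ} (hH : 0 < H) (r : ℕ) (κ : ℤ) :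
    ‖1 - unitExp ((max 1 κ.natAbs : ℕ) * r / H)‖ ≤
      Real.pi * (max 1 κ.natAbs : ℕ) / H * ‖arcSum (2 * H) r κ‖ := by
  have hH' : (0 : ℝ) < H := by exact_mod_cast hH
  by_cases hκ : κ = 0
  · subst hκ
    refine (norm_one_sub_unitExp_le _).trans_eq ?_
    have : arcSum (2 * H) r 0 = (2 * r : ℕ) := by
      simp [arcSum, unitExp_zero]
      norm_cast
      omega
    rw [this, abs_of_nonneg (by positivity)]
    simp
    field_simp
  · have hmax : max 1 κ.natAbs = κ.natAbs := max_eq_right (by omega)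
    rw [hmax]
    have h1 : ‖1 - unitExp ((κ.natAbs : ℕ) * r / H)‖ = ‖1 - unitExp (κ * r / H)‖ := by
      rcases Int.natAbs_eq κ with h | h
      · conv_rhs => rw [h]
        simp
      · conv_rhs => rw [h]
        rw [← norm_one_sub_unitExp_neg]
        congr 3
        rw [Int.cast_neg, Int.cast_natCast]
        ring
    have h2 : arcSum (2 * H) r κ = unitExp (-(κ * r / (2 * H : ℕ))) *
        ∑ t ∈ Finset.range (2 * r), unitExp (κ / (2 * H : ℕ)) ^ t := by
      unfold arcSum
      rw [Finset.mul_sum]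
      refine Finset.sum_nbij' (fun u => (u + r).toNat) (fun t => (t : ℤ) - r) ?_ ?_ ?_ ?_ ?_
      · intro j hj
        simp only [Finset.mem_Ico, Finset.mem_range] at *
        omega
      · intro j hj
        simp only [Finset.mem_Ico, Finset.mem_range] at *
        omega
      · intro j hj
        simp only [Finset.mem_Ico] at *
        omega
      · intro j hj
        simp
      · intro j hj
        have : (((j + r).toNat : ℤ) : ℝ) = ((j + r : ℤ) : ℝ) := by
          rw [Int.toNat_of_nonneg]
          simp only [Finset.mem_Ico] at hj
          omega
        rw [← unitExp_nat_mul, ← unitExp_add, ← Int.cast_natCast (j + r).toNat, this]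
        congr 1
        push_cast
        ring
    have h3 : ‖1 - unitExp (κ * r / H)‖ =
        ‖arcSum (2 * H) r κ‖ * ‖1 - unitExp (κ / (2 * H : ℕ))‖ := by
      rw [h2, norm_mul, norm_unitExp, one_mul, ← norm_mul, geom_sum_mul_neg, ← unitExp_nat_mul]
      congr 3
      push_cast
      field_simp
    rw [h1, h3, mul_comm]
    refine mul_le_mul_of_nonneg_right ((norm_one_sub_unitExp_le _).trans_eq ?_) (norm_nonneg _)
    rw [abs_div, Nat.abs_cast, Nat.cast_natAbs, Int.cast_abs]
    push_cast
    field_simp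

/-! ### Averaging over the radii -/

lemma one_sub_sum_le_prod {ι : Type*} (s : Finset ι) (x : ι → ℝ) (h0 : ∀ i ∈ s, 0 ≤ x i)
    (h1 : ∀ i ∈ s, x i ≤ 1) : 1 - ∑ i ∈ s, x i ≤ ∏ i ∈ s, (1 - x i) := by
  classical
  induction s using Finset.induction_on with
  | empty => simp
  | insert a s ha ih =>
    rw [Finset.sum_insert ha, Finset.prod_insert ha]
    have h := ih (fun i hi => h0 i (Finset.mem_insert_of_mem hi))
      (fun i hi => h1 i (Finset.mem_insert_of_mem hi))
    have ha0 := h0 a (Finset.mem_insert_self a s)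
    have ha1 := h1 a (Finset.mem_insert_self a s)
    have hs : 0 ≤ ∑ i ∈ s, x i :=
      Finset.sum_nonneg fun i hi => h0 i (Finset.mem_insert_of_mem hi)
    have := mul_le_mul_of_nonneg_left h (sub_nonneg.2 ha1)
    nlinarith [mul_nonneg ha0 hs]

/-- The normalized Fejér kernel `|n⁻¹ ∑_{j<n} z^j|²` peaks at `z = 1`, so that its distance from `1`
is controlled by `|1 - z|`. -/
lemma sq_one_sub_fejer_le {n : ℕ} (hn : 0 < n) {z : ℂ} (hz : ‖z‖ = 1) :
    ‖(n : ℂ)⁻¹ * ∑ j ∈ Finset.range n, z ^ j‖ ^ 2 ≤ 1 ∧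
      (1 - ‖(n : ℂ)⁻¹ * ∑ j ∈ Finset.range n, z ^ j‖ ^ 2) ^ 2 ≤ (4 * (n : ℝ) ^ 2) * ‖1 - z‖ ^ 2 := by
  have hn' : (0 : ℝ) < n := by exact_mod_cast hn
  have hnc : (n : ℂ) ≠ 0 := by exact_mod_cast hn.ne'
  set w : ℂ := (n : ℂ)⁻¹ * ∑ j ∈ Finset.range n, z ^ j with hw
  have hw1 : ‖w‖ ≤ 1 := by
    rw [hw, norm_mul, norm_inv, Complex.norm_natCast, inv_mul_le_iff₀ hn', mul_one]
    refine (norm_sum_le _ _).trans ?_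
    simp [hz]
  have hpow : ∀ j : ℕ, ‖1 - z ^ j‖ ≤ j * ‖1 - z‖ := by
    intro j
    rw [← geom_sum_mul_neg, norm_mul]
    refine mul_le_mul_of_nonneg_right ((norm_sum_le _ _).trans ?_) (norm_nonneg _)
    simp [hz]
  have hw2 : ‖1 - w‖ ≤ n * ‖1 - z‖ := by
    have e : 1 - w = (n : ℂ)⁻¹ * ∑ j ∈ Finset.range n, (1 - z ^ j) := by
      rw [Finset.sum_sub_distrib, mul_sub]
      simp [hw, hnc]
    rw [e, norm_mul, norm_inv, Complex.norm_natCast, inv_mul_le_iff₀ hn']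
    refine (norm_sum_le _ _).trans ((Finset.sum_le_card_nsmul _ _ (n * ‖1 - z‖) ?_).trans_eq ?_)
    · intro j hj
      refine (hpow j).trans (mul_le_mul_of_nonneg_right ?_ (norm_nonneg _))
      exact_mod_cast (Finset.mem_range.1 hj).le
    · simp
  have hw3 : 1 - ‖w‖ ≤ ‖1 - w‖ := by
    have := norm_sub_norm_le (1 : ℂ) w
    simpa using this
  have hw0 := norm_nonneg w
  refine ⟨by nlinarith, ?_⟩
  have h4 : 1 - ‖w‖ ^ 2 ≤ 2 * (n * ‖1 - z‖) := by nlinarith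
  have h5 : 0 ≤ 1 - ‖w‖ ^ 2 := by nlinarith
  calc (1 - ‖w‖ ^ 2) ^ 2 ≤ (2 * (n * ‖1 - z‖)) ^ 2 := by gcongr
    _ = _ := by ring

/-- The mean of the normalized Fejér kernel over the cyclic group of order `H`, dilated by a
frequency `k` too small to alias. -/
lemma sum_fejer_eq {n H k : ℕ} (hn : 0 < n) (hk : 0 < k) (hnk : (n - 1) * k < H) :
    ∑ r ∈ Finset.range H, ‖(n : ℂ)⁻¹ * ∑ j ∈ Finset.range n, unitExp (k * r / H) ^ j‖ ^ 2 =
      H / n := by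
  have hH : 0 < H := by omega
  have hn' : (n : ℝ) ≠ 0 := by positivity
  have e : ∀ r : ℕ, ((‖∑ j ∈ Finset.range n, unitExp (k * r / H) ^ j‖ ^ 2 : ℝ) : ℂ) =
      ∑ a ∈ Finset.range n, ∑ b ∈ Finset.range n,
        unitExp ((((a : ℤ) - b) * k : ℤ) * r / H) := by
    intro r
    rw [Complex.ofReal_pow, ← Complex.mul_conj', map_sum, Finset.sum_mul_sum]
    refine Finset.sum_congr rfl fun a _ => Finset.sum_congr rfl fun b _ => ?_
    rw [← unitExp_nat_mul, ← unitExp_nat_mul, ← unitExp_sub]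
    congr 1
    push_cast
    ring
  have e2 : ((∑ r ∈ Finset.range H,
      ‖∑ j ∈ Finset.range n, unitExp (k * r / H) ^ j‖ ^ 2 : ℝ) : ℂ) = ((n * H : ℝ) : ℂ) := by
    push_cast at e ⊢
    simp_rw [e]
    rw [Finset.sum_comm]
    have : ∀ a ∈ Finset.range n, ∑ r ∈ Finset.range H, ∑ b ∈ Finset.range n,
        unitExp (((a : ℝ) - b) * k * r / H) = (H : ℂ) := by
      intro a ha
      rw [Finset.sum_comm]
      have h2 : ∀ b ∈ Finset.range n, ∑ r ∈ Finset.range H,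
          unitExp (((a : ℝ) - b) * k * r / H) = if a = b then (H : ℂ) else 0 := by
        intro b hb
        have h := sum_range_unitExp hH (((a : ℤ) - b) * k)
        push_cast at h
        rw [h]
        refine if_congr ⟨fun hd => ?_, fun hab => by simp [hab]⟩ rfl rfl
        by_contra hab
        have hab' : ((a : ℤ) - b) ≠ 0 := by omega
        have hne : ((a : ℤ) - b) * k ≠ 0 := mul_ne_zero hab' (by omega)
        have hle := Int.le_of_dvd (abs_pos.2 hne) ((dvd_abs _ _).2 hd)
        rw [abs_mul, Nat.abs_cast] at hle
        have habs : |(a : ℤ) - b| ≤ ((n - 1 : ℕ) : ℤ) := by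
          rw [abs_le]
          simp only [Finset.mem_range] at ha hb
          omega
        have : |(a : ℤ) - b| * k ≤ ((n - 1 : ℕ) : ℤ) * k := by gcongr
        have hnk' : ((n - 1 : ℕ) : ℤ) * k < H := by exact_mod_cast hnk
        omega
      rw [Finset.sum_congr rfl h2, Finset.sum_ite_eq, if_pos ha]
    rw [Finset.sum_congr rfl this]
    simp
  have e3 := Complex.ofReal_injective e2
  simp_rw [norm_mul, mul_pow, ← Finset.mul_sum, e3, norm_inv, Complex.norm_natCast]
  field_simp

/-- The average over the radii of `∏ |1 - exp (2πi kᵢ r / H)|²` is bounded below uniformly in the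
small frequencies `kᵢ`. -/
lemma le_sum_prod_norm_one_sub_unitExp {d H : ℕ} (k : Fin d → ℕ) (hk0 : ∀ i, 0 < k i)
    (hk : ∀ i, 2 * d * k i < H) :
    (H : ℝ) / ((2 * d + 1) * (4 * (2 * d + 1) ^ 2) ^ d) ≤
      ∑ r ∈ Finset.range H, ∏ i, ‖1 - unitExp (k i * r / H)‖ ^ 2 := by
  set n : ℕ := 2 * d + 1 with hn
  have hn0 : 0 < n := by omega
  have hn' : (2 * d + 1 : ℝ) = n := by rw [hn]; push_cast; ring
  have hnpos : (0 : ℝ) < n := by exact_mod_cast hn0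
  rw [hn']
  set h : Fin d → ℕ → ℝ := fun i r =>
    ‖(n : ℂ)⁻¹ * ∑ j ∈ Finset.range n, unitExp (k i * r / H) ^ j‖ ^ 2 with hh
  have hb : ∀ i r, 0 ≤ h i r ∧ h i r ≤ 1 := fun i r =>
    ⟨by positivity, (sq_one_sub_fejer_le hn0 (norm_unitExp _)).1⟩
  have hr : ∀ r : ℕ, 1 - 2 * ∑ i, h i r ≤
      (4 * (n : ℝ) ^ 2) ^ d * ∏ i, ‖1 - unitExp (k i * r / H)‖ ^ 2 := by
    intro r
    calc 1 - 2 * ∑ i, h i r ≤ 1 - ∑ i, (2 * h i r - h i r ^ 2) := by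
          rw [Finset.mul_sum]
          gcongr with i
          nlinarith [sq_nonneg (h i r)]
      _ ≤ ∏ i, (1 - (2 * h i r - h i r ^ 2)) :=
          one_sub_sum_le_prod _ _ (fun i _ => by nlinarith [hb i r])
            (fun i _ => by nlinarith [hb i r, sq_nonneg (1 - h i r)])
      _ = ∏ i, (1 - h i r) ^ 2 := Finset.prod_congr rfl fun i _ => by ring
      _ ≤ ∏ i, ((4 * (n : ℝ) ^ 2) * ‖1 - unitExp (k i * r / H)‖ ^ 2) :=
          Finset.prod_le_prod (fun i _ => sq_nonneg _)
            fun i _ => (sq_one_sub_fejer_le hn0 (norm_unitExp _)).2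
      _ = _ := by rw [Finset.prod_mul_distrib]; simp
  have hs : ∑ r ∈ Finset.range H, (1 - 2 * ∑ i, h i r) = (H : ℝ) / n := by
    rw [Finset.sum_sub_distrib, ← Finset.mul_sum, Finset.sum_comm]
    rw [Finset.sum_congr rfl fun i _ => sum_fejer_eq hn0 (hk0 i) (by simpa [hn] using hk i)]
    simp
    field_simp
    rw [← hn']
    ring
  rw [div_mul_eq_div_div, div_le_iff₀ (by positivity), ← hs, mul_comm, Finset.mul_sum]
  exact Finset.sum_le_sum fun r _ => hr r

/-! ### Large values of exponential sums -/

/-- Cassels' lower bound for the mean square of an exponential sum over a box of frequencies: the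
sum of `|pointSum (a - b)|²` over `a`, `b` in a box equals a sum of squares over pairs of points, of
which the diagonal pairs alone contribute `N` times the squared volume of the box. -/
lemma le_sum_norm_pointSum_sq {d N : ℕ} (M : ℕ) (q : Fin N → Fin d → ℤ) (K : Fin d → ℕ)
    (hK : ∀ i, 0 < K i) :
    (N : ℝ) * ∏ i, (K i : ℝ) ≤
      ∑ k ∈ Fintype.piFinset (fun i => Finset.Ioo (-(K i : ℤ)) (K i)), ‖pointSum M q k‖ ^ 2 := by
  classical
  set A : Finset (Fin d → ℤ) := Fintype.piFinset (fun i => Finset.Ico (0 : ℤ) (K i)) with hA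
  set B : Finset (Fin d → ℤ) :=
    Fintype.piFinset (fun i => Finset.Ioo (-(K i : ℤ)) (K i)) with hB
  have hcard : (A.card : ℝ) = ∏ i, (K i : ℝ) := by
    rw [hA, Fintype.card_piFinset]
    simp
  have hcpos : 0 < (A.card : ℝ) := by
    rw [hcard]
    exact Finset.prod_pos fun i _ => by exact_mod_cast hK i
  have expand : ((∑ a ∈ A, ∑ b ∈ A, ‖pointSum M q (a - b)‖ ^ 2 : ℝ) : ℂ) =
      ((∑ n, ∑ m, ‖∑ a ∈ A, gridChar M a (q n - q m)‖ ^ 2 : ℝ) : ℂ) := by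
    have e1 : ∀ a b : Fin d → ℤ, ((‖pointSum M q (a - b)‖ ^ 2 : ℝ) : ℂ) =
        ∑ n, ∑ m, (starRingEnd ℂ) (gridChar M a (q n - q m)) * gridChar M b (q n - q m) := by
      intro a b
      rw [Complex.ofReal_pow, ← Complex.mul_conj']
      unfold pointSum
      rw [map_sum, Finset.sum_mul_sum]
      refine Finset.sum_congr rfl fun n _ => Finset.sum_congr rfl fun m _ => ?_
      rw [← gridChar_mul_conj, ← gridChar_mul_conj, gridChar_sub, gridChar_sub]
      simp only [map_mul, Complex.conj_conj]
      ring
    have e2 : ∀ n m : Fin N, ((‖∑ a ∈ A, gridChar M a (q n - q m)‖ ^ 2 : ℝ) : ℂ) =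
        ∑ a ∈ A, ∑ b ∈ A,
          (starRingEnd ℂ) (gridChar M a (q n - q m)) * gridChar M b (q n - q m) := by
      intro n m
      rw [Complex.ofReal_pow, ← Complex.conj_mul', map_sum, Finset.sum_mul_sum]
    push_cast at e1 e2 ⊢
    simp_rw [e1, e2]
    simp_rw [Finset.sum_comm (s := A) (t := Finset.univ)]
  have expand' := Complex.ofReal_injective expand
  have diag : (N : ℝ) * (A.card : ℝ) ^ 2 ≤ ∑ a ∈ A, ∑ b ∈ A, ‖pointSum M q (a - b)‖ ^ 2 := by
    rw [expand']
    have : ∀ n : Fin N, (A.card : ℝ) ^ 2 ≤ ∑ m, ‖∑ a ∈ A, gridChar M a (q n - q m)‖ ^ 2 := by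
      intro n
      refine le_trans (le_of_eq ?_) (Finset.single_le_sum (fun m _ => sq_nonneg _)
        (Finset.mem_univ n))
      simp [gridChar, unitExp_zero]
    calc (N : ℝ) * (A.card : ℝ) ^ 2 = ∑ _n : Fin N, (A.card : ℝ) ^ 2 := by simp
      _ ≤ _ := Finset.sum_le_sum fun n _ => this n
  have group : ∑ a ∈ A, ∑ b ∈ A, ‖pointSum M q (a - b)‖ ^ 2 ≤
      A.card * ∑ k ∈ B, ‖pointSum M q k‖ ^ 2 := by
    rw [← nsmul_eq_mul]
    rw [Finset.sum_comm]
    refine Finset.sum_le_card_nsmul _ _ _ fun b hb => ?_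
    rw [← Finset.sum_image (f := fun k => ‖pointSum M q k‖ ^ 2) (g := fun a => a - b)
      (fun x _ y _ h => sub_left_injective h)]
    refine Finset.sum_le_sum_of_subset_of_nonneg ?_ fun _ _ _ => sq_nonneg _
    intro k hk
    obtain ⟨a, ha, rfl⟩ := Finset.mem_image.1 hk
    rw [hA, Fintype.mem_piFinset] at ha hb
    rw [hB, Fintype.mem_piFinset]
    intro i
    have h1 := Finset.mem_Ico.1 (ha i)
    have h2 := Finset.mem_Ico.1 (hb i)
    rw [Finset.mem_Ioo, Pi.sub_apply]
    omega
  rw [← hcard]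
  have := diag.trans group
  nlinarith

/-! ### Dyadic boxes of frequencies -/

/-- The shapes of the dyadic boxes of volume `2 ^ L`, up to constants: exponents with sum `L`. -/
def dyadicShapes (d L : ℕ) : Finset (Fin d → ℕ) :=
  (Fintype.piFinset (fun _ : Fin d => Finset.range (L + 1))).filter (fun a => ∑ i, a i = L)

/-- The frequencies `k` with `|kᵢ| < 2 ^ aᵢ` for all `i`. -/
noncomputable def dyadicBox {d : ℕ} (a : Fin d → ℕ) : Finset (Fin d → ℤ) :=
  Fintype.piFinset (fun i => Finset.Ioo (-((2 ^ a i : ℕ) : ℤ)) ((2 ^ a i : ℕ) : ℤ))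

/-- All exponents but the first may be chosen freely in `[0, L / d]`. -/
lemma pow_le_card_dyadicShapes (m L : ℕ) :
    (L / (m + 1) + 1) ^ m ≤ (dyadicShapes (m + 1) L).card := by
  have h : (Fintype.piFinset (fun _ : Fin m => Finset.range (L / (m + 1) + 1))).card =
      (L / (m + 1) + 1) ^ m := by simp
  rw [← h]
  refine Finset.card_le_card_of_injOn
    (fun b => (Fin.cons (L - ∑ i, b i) b : Fin (m + 1) → ℕ)) ?_ ?_
  · intro b hb
    have hb' : ∀ i, b i ≤ L / (m + 1) := fun i => by
      have := Finset.mem_range.1 (Fintype.mem_piFinset.1 (Finset.mem_coe.1 hb) i)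
      omega
    have hs : ∑ i, b i ≤ L := by
      calc ∑ i, b i ≤ ∑ _i : Fin m, L / (m + 1) := Finset.sum_le_sum fun i _ => hb' i
        _ = m * (L / (m + 1)) := by simp
        _ ≤ (m + 1) * (L / (m + 1)) := by gcongr; omega
        _ ≤ L := Nat.mul_div_le _ _
    have hle : ∀ i, b i ≤ L := fun i => (hb' i).trans (Nat.div_le_self _ _)
    simp only [dyadicShapes, Finset.coe_filter, Set.mem_ofPred_eq, Fintype.mem_piFinset,
      Finset.mem_range]
    refine ⟨fun i => ?_, ?_⟩
    · refine Fin.cases ?_ (fun i => ?_) i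
      · simp only [Fin.cons_zero]
        omega
      · have := hle i
        simp only [Fin.cons_succ]
        omega
    · rw [Fin.sum_univ_succ]
      simp only [Fin.cons_zero, Fin.cons_succ]
      omega
  · intro b _ c _ hbc
    exact (Fin.cons_injective2 hbc).2

lemma sum_range_ite_le_pow {x : ℕ} (hx : 0 < x) (n : ℕ) :
    ∑ a ∈ Finset.range n, (if x ≤ 2 ^ a then (1 / 4 : ℝ) ^ a else 0) ≤ (4 / 3) * (1 / (x : ℝ) ^ 2) := by
  rw [← Finset.sum_filter]
  set b := Nat.clog 2 x with hb
  have hxb : (x : ℝ) ≤ 2 ^ b := by exact_mod_cast Nat.le_pow_clog (by norm_num) x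
  have hx' : (0 : ℝ) < x := by exact_mod_cast hx
  calc ∑ a ∈ (Finset.range n).filter (fun a => x ≤ 2 ^ a), (1 / 4 : ℝ) ^ a
      ≤ ∑ a ∈ Finset.Ico b n, (1 / 4 : ℝ) ^ a := by
        refine Finset.sum_le_sum_of_subset_of_nonneg ?_ fun _ _ _ => by positivity
        intro a ha
        rw [Finset.mem_filter, Finset.mem_range] at ha
        rw [Finset.mem_Ico]
        exact ⟨Nat.clog_le_of_le_pow ha.2, ha.1⟩
    _ ≤ (1 / 4 : ℝ) ^ b / (1 - 1 / 4) := geom_sum_Ico_le_of_lt_one (by norm_num) (by norm_num)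
    _ = (4 / 3) * (1 / ((2 : ℝ) ^ b) ^ 2) := by
        rw [one_div_pow, ← pow_mul, mul_comm b 2, pow_mul]
        norm_num
        ring
    _ ≤ (4 / 3) * (1 / (x : ℝ) ^ 2) := by gcongr

/-- The boxes of volume about `2 ^ L` that contain `k`, each weighted by `4 ^ (-L)`, have total weight
at most a constant times `∏ max(1, |kᵢ|)⁻²`: dropping the constraint on the sum of the exponents
leaves a product of geometric series. -/
lemma sum_dyadicShapes_ite_le {d : ℕ} (L : ℕ) (k : Fin d → ℤ) :
    ∑ a ∈ dyadicShapes d L, (if k ∈ dyadicBox a then (1 / 4 : ℝ) ^ L else 0) ≤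
      (4 / 3) ^ d * ∏ i, (1 / ((max 1 (k i).natAbs : ℕ) : ℝ) ^ 2) := by
  calc ∑ a ∈ dyadicShapes d L, (if k ∈ dyadicBox a then (1 / 4 : ℝ) ^ L else 0)
      ≤ ∑ a ∈ dyadicShapes d L,
          ∏ i, (if max 1 (k i).natAbs ≤ 2 ^ a i then (1 / 4 : ℝ) ^ a i else 0) := by
        refine Finset.sum_le_sum fun a ha => ?_
        split_ifs with h
        · rw [← (Finset.mem_filter.1 ha).2, ← Finset.prod_pow_eq_pow_sum]
          refine (Finset.prod_congr rfl fun i _ => (if_pos ?_).symm).le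
          have h1 := Finset.mem_Ioo.1 (Fintype.mem_piFinset.1 h i)
          have h2 : 0 < 2 ^ a i := by positivity
          omega
        · refine Finset.prod_nonneg fun i _ => ?_
          split_ifs <;> positivity
    _ ≤ ∑ a ∈ Fintype.piFinset (fun _ : Fin d => Finset.range (L + 1)),
          ∏ i, (if max 1 (k i).natAbs ≤ 2 ^ a i then (1 / 4 : ℝ) ^ a i else 0) := by
        refine Finset.sum_le_sum_of_subset_of_nonneg (Finset.filter_subset _ _) fun a _ _ => ?_
        refine Finset.prod_nonneg fun i _ => ?_
        split_ifs <;> positivity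
    _ = ∏ i, ∑ a ∈ Finset.range (L + 1),
          (if max 1 (k i).natAbs ≤ 2 ^ a then (1 / 4 : ℝ) ^ a else 0) :=
        (Finset.prod_univ_sum (t := fun _ => Finset.range (L + 1))
          (f := fun i a => if max 1 (k i).natAbs ≤ 2 ^ a then (1 / 4 : ℝ) ^ a else 0)).symm
    _ ≤ ∏ i : Fin d, ((4 / 3) * (1 / ((max 1 (k i).natAbs : ℕ) : ℝ) ^ 2)) := by
        refine Finset.prod_le_prod (fun i _ => ?_) fun i _ =>
          sum_range_ite_le_pow (lt_max_of_lt_left one_pos) _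
        refine Finset.sum_nonneg fun a _ => ?_
        split_ifs <;> positivity
    _ = _ := by rw [Finset.prod_mul_distrib, Finset.prod_const, Finset.card_univ,
          Fintype.card_fin]

/-- The nonzero frequencies `k` with `|kᵢ| < 2 ^ L` for all `i`. -/
noncomputable def lowFrequencies (d L : ℕ) : Finset (Fin d → ℤ) :=
  (dyadicBox (fun _ : Fin d => L)).erase 0

lemma abs_lt_of_mem_lowFrequencies {d L : ℕ} {k : Fin d → ℤ} (hk : k ∈ lowFrequencies d L)
    (i : Fin d) : -((2 ^ L : ℕ) : ℤ) < k i ∧ k i < ((2 ^ L : ℕ) : ℤ) :=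
  Finset.mem_Ioo.1 (Fintype.mem_piFinset.1 (Finset.mem_of_mem_erase hk) i)

/-- Each dyadic box of volume about `N` contributes a constant to the weighted mean square of the
exponential sum. -/
lemma card_dyadicShapes_le {d N L : ℕ} (M : ℕ) (q : Fin N → Fin d → ℤ)
    (hL1 : 2 * N ≤ 2 ^ L) (hL2 : 2 ^ L ≤ 4 * N) :
    (3 / 4 : ℝ) ^ d / 8 * (dyadicShapes d L).card ≤
      ∑ k ∈ lowFrequencies d L,
        ‖pointSum M q k‖ ^ 2 * ∏ i, (1 / ((max 1 (k i).natAbs : ℕ) : ℝ) ^ 2) := by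
  have h1 : (2 * N : ℝ) ≤ 2 ^ L := by exact_mod_cast hL1
  have h2 : (2 ^ L : ℝ) ≤ 4 * N := by exact_mod_cast hL2
  have hbox : ∀ a ∈ dyadicShapes d L,
      (1 / 8 : ℝ) ≤ (1 / 4 : ℝ) ^ L * ∑ k ∈ (dyadicBox a).erase 0, ‖pointSum M q k‖ ^ 2 := by
    intro a ha
    have hc := le_sum_norm_pointSum_sq M q (fun i => 2 ^ a i) (fun i => by positivity)
    have hvol : ∏ i, (((2 ^ a i : ℕ) : ℝ)) = 2 ^ L := by
      rw [← (Finset.mem_filter.1 ha).2, ← Finset.prod_pow_eq_pow_sum]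
      push_cast
      rfl
    rw [hvol] at hc
    have hmem : (0 : Fin d → ℤ) ∈ dyadicBox a := by
      refine Fintype.mem_piFinset.2 fun i => Finset.mem_Ioo.2 ?_
      have h2 : 0 < 2 ^ a i := by positivity
      rw [Pi.zero_apply]
      omega
    have hzero : ‖pointSum M q 0‖ ^ 2 = (N : ℝ) ^ 2 := by
      simp [pointSum, gridChar, unitExp_zero]
    have hsplit := Finset.add_sum_erase (dyadicBox a) (fun k => ‖pointSum M q k‖ ^ 2) hmem
    simp only [hzero] at hsplit
    have hc' : (N : ℝ) * 2 ^ L - N ^ 2 ≤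
        ∑ k ∈ (dyadicBox a).erase 0, ‖pointSum M q k‖ ^ 2 := by
      have : (N : ℝ) * 2 ^ L ≤ ∑ k ∈ dyadicBox a, ‖pointSum M q k‖ ^ 2 := hc
      linarith
    have h4 : (4 : ℝ) ^ L = (2 ^ L) ^ 2 := by
      rw [← pow_mul, mul_comm, pow_mul]
      norm_num
    rw [one_div_pow, one_div_mul_eq_div, le_div_iff₀ (by positivity), h4]
    refine le_trans ?_ hc'
    nlinarith [mul_nonneg (sub_nonneg.2 h1) (sub_nonneg.2 h2)]
  have hswap : ∑ a ∈ dyadicShapes d L,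
        (1 / 4 : ℝ) ^ L * ∑ k ∈ (dyadicBox a).erase 0, ‖pointSum M q k‖ ^ 2 =
      ∑ k ∈ lowFrequencies d L, ‖pointSum M q k‖ ^ 2 *
        ∑ a ∈ dyadicShapes d L, (if k ∈ dyadicBox a then (1 / 4 : ℝ) ^ L else 0) := by
    simp_rw [Finset.mul_sum]
    rw [Finset.sum_comm]
    refine Finset.sum_congr rfl fun a ha => ?_
    have hsub : (dyadicBox a).erase 0 =
        (lowFrequencies d L).filter (fun k => k ∈ dyadicBox a) := by
      ext k
      simp only [lowFrequencies, Finset.mem_erase, Finset.mem_filter]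
      refine ⟨fun h => ⟨⟨h.1, ?_⟩, h.2⟩, fun h => ⟨h.1.1, h.2⟩⟩
      refine Fintype.mem_piFinset.2 fun i => Finset.mem_Ioo.2 ?_
      have h1 := Finset.mem_Ioo.1 (Fintype.mem_piFinset.1 h.2 i)
      have h3 := Finset.mem_range.1 (Fintype.mem_piFinset.1 (Finset.mem_filter.1 ha).1 i)
      have h4 : 2 ^ a i ≤ 2 ^ L := Nat.pow_le_pow_right (by norm_num) (by omega)
      change -((2 ^ L : ℕ) : ℤ) < k i ∧ k i < ((2 ^ L : ℕ) : ℤ)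
      omega
    rw [hsub, Finset.sum_filter]
    refine Finset.sum_congr rfl fun k _ => ?_
    split_ifs <;> ring
  have hA : (1 / 8 : ℝ) * (dyadicShapes d L).card ≤
      (4 / 3) ^ d * ∑ k ∈ lowFrequencies d L,
        ‖pointSum M q k‖ ^ 2 * ∏ i, (1 / ((max 1 (k i).natAbs : ℕ) : ℝ) ^ 2) := by
    calc (1 / 8 : ℝ) * (dyadicShapes d L).card = ∑ _a ∈ dyadicShapes d L, (1 / 8 : ℝ) := by
          simp [mul_comm]
      _ ≤ _ := Finset.sum_le_sum hbox
      _ = _ := hswap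
      _ ≤ ∑ k ∈ lowFrequencies d L, ‖pointSum M q k‖ ^ 2 *
            ((4 / 3) ^ d * ∏ i, (1 / ((max 1 (k i).natAbs : ℕ) : ℝ) ^ 2)) := by
          gcongr with k
          exact sum_dyadicShapes_ite_le L k
      _ = _ := by
          rw [Finset.mul_sum]
          exact Finset.sum_congr rfl fun k _ => by ring
  have h34 : (3 / 4 : ℝ) ^ d * (4 / 3) ^ d = 1 := by
    rw [← mul_pow]
    norm_num
  calc (3 / 4 : ℝ) ^ d / 8 * (dyadicShapes d L).card
      = (3 / 4 : ℝ) ^ d * ((1 / 8 : ℝ) * (dyadicShapes d L).card) := by ring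
    _ ≤ (3 / 4 : ℝ) ^ d * ((4 / 3) ^ d * ∑ k ∈ lowFrequencies d L,
        ‖pointSum M q k‖ ^ 2 * ∏ i, (1 / ((max 1 (k i).natAbs : ℕ) : ℝ) ^ 2)) := by gcongr
    _ = _ := by rw [← mul_assoc, h34, one_mul]

/-! ### The lower bound for the discrepancy -/

/-- Bessel's inequality bounds the mean square over the centers, at a fixed radius, from below by the
low frequencies. -/
lemma sum_lowFrequencies_le_sum_discrepancy {d N H L r : ℕ} (hr : r < H) (hLH : 2 ^ L ≤ H)
    (x : Fin N → Fin d → ℝ) :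
    ∑ k ∈ lowFrequencies d L,
        ‖pointSum (2 * H) (fun n i => ⌊((2 * H : ℕ) : ℝ) * x n i⌋) k‖ ^ 2 *
          ((H / Real.pi) ^ (2 * d) * (∏ i, (1 / ((max 1 (k i).natAbs : ℕ) : ℝ) ^ 2)) *
            ∏ i, ‖1 - unitExp ((max 1 (k i).natAbs : ℕ) * r / H)‖ ^ 2) ≤
      ((2 * H : ℕ) : ℝ) ^ d * ∑ j ∈ Fintype.piFinset (fun _ : Fin d => gridIndices (2 * H)),
        |discrepancy (translatedCube (Torus.proj (fun i => (j i : ℝ) / (2 * H : ℕ)))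
          ((r : ℝ) / (2 * H : ℕ))) (fun n => Torus.proj (x n))| ^ 2 := by
  have hH : 0 < H := by omega
  have hH' : (0 : ℝ) < H := by exact_mod_cast hH
  have hsmall : ∀ c : ℤ, c ≠ 0 → |c| < ((2 * H : ℕ) : ℤ) → ¬ ((2 * H : ℕ) : ℤ) ∣ c := by
    intro c hc h hd
    have := Int.le_of_dvd (abs_pos.2 hc) ((dvd_abs _ _).2 hd)
    omega
  have bessel := sum_norm_sq_le_of_orthogonal
    (Fintype.piFinset (fun _ : Fin d => gridIndices (2 * H))) (lowFrequencies d L)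
    (gridChar (2 * H)) (W := ((2 * H : ℕ) : ℝ) ^ d) (by positivity) (by
      intro k hk l hl
      simp_rw [gridChar_mul_conj]
      split_ifs with h
      · subst h
        simp [gridChar, unitExp_zero, card_gridIndices]
      · refine sum_gridChar_eq_zero hH _ ?_
        obtain ⟨i, hi⟩ := Function.ne_iff.1 h
        have h1 := abs_lt_of_mem_lowFrequencies hk i
        have h2 := abs_lt_of_mem_lowFrequencies hl i
        refine ⟨i, hsmall _ (sub_ne_zero.2 hi) ?_⟩
        rw [Pi.sub_apply, abs_lt]
        omega)
    (fun j => ((discrepancy (translatedCube (Torus.proj (fun i => (j i : ℝ) / (2 * H : ℕ)))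
          ((r : ℝ) / (2 * H : ℕ))) (fun n => Torus.proj (x n)) : ℝ) : ℂ))
  simp only [Complex.norm_real, Real.norm_eq_abs] at bessel
  refine le_trans (Finset.sum_le_sum fun k hk => ?_) bessel
  have hk0 : ∃ i, ¬ ((2 * H : ℕ) : ℤ) ∣ k i := by
    obtain ⟨i, hi⟩ := Function.ne_iff.1 (Finset.ne_of_mem_erase hk)
    have h1 := abs_lt_of_mem_lowFrequencies hk i
    refine ⟨i, hsmall _ hi ?_⟩
    rw [abs_lt]
    omega
  rw [sum_discrepancy_mul_conj_gridChar hr x k hk0, norm_mul, mul_pow, mul_comm]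
  refine mul_le_mul_of_nonneg_right ?_ (sq_nonneg _)
  have e : (H / Real.pi : ℝ) ^ (2 * d) = ∏ _i : Fin d, (H / Real.pi : ℝ) ^ 2 := by
    simp [pow_mul]
  rw [e, ← Finset.prod_mul_distrib, ← Finset.prod_mul_distrib, norm_prod, ← Finset.prod_pow]
  refine Finset.prod_le_prod (fun i _ => by positivity) fun i _ => ?_
  have hm : (0 : ℝ) < (max 1 (k i).natAbs : ℕ) := by
    exact_mod_cast lt_max_of_lt_left one_pos
  calc (H / Real.pi : ℝ) ^ 2 * (1 / ((max 1 (k i).natAbs : ℕ) : ℝ) ^ 2) *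
        ‖1 - unitExp ((max 1 (k i).natAbs : ℕ) * r / H)‖ ^ 2
      ≤ (H / Real.pi : ℝ) ^ 2 * (1 / ((max 1 (k i).natAbs : ℕ) : ℝ) ^ 2) *
        (Real.pi * (max 1 (k i).natAbs : ℕ) / H * ‖arcSum (2 * H) r (k i)‖) ^ 2 := by
        gcongr
        exact norm_one_sub_unitExp_le_arcSum hH r (k i)
    _ = ‖arcSum (2 * H) r (k i)‖ ^ 2 := by
        have := Real.pi_ne_zero
        field_simp

/-- The mean square discrepancy, before normalization, is at least a constant times the number of
dyadic boxes of volume about `N`. -/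
lemma card_dyadicShapes_le_sum_discrepancy {d N H L : ℕ} (hd : 1 ≤ d) (hN : 1 ≤ N)
    (hH : 9 * d * N ≤ H) (hL1 : 2 * N ≤ 2 ^ L) (hL2 : 2 ^ L ≤ 4 * N) (x : Fin N → Fin d → ℝ) :
    (H / Real.pi) ^ (2 * d) * (H / ((2 * d + 1) * (4 * (2 * d + 1) ^ 2) ^ d)) *
        ((3 / 4 : ℝ) ^ d / 8 * (dyadicShapes d L).card) ≤
      ((2 * H : ℕ) : ℝ) ^ d * ∑ r ∈ Finset.Ico 1 H,
        ∑ j ∈ Fintype.piFinset (fun _ : Fin d => gridIndices (2 * H)),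
          |discrepancy (translatedCube (Torus.proj (fun i => (j i : ℝ) / (2 * H : ℕ)))
            ((r : ℝ) / (2 * H : ℕ))) (fun n => Torus.proj (x n))| ^ 2 := by
  have hdN : 1 * N ≤ d * N := by gcongr
  have hdN' : 9 * (d * N) ≤ H := by linarith
  have hHpos : 0 < H := by omega
  rw [Finset.mul_sum]
  refine le_trans ?_ (Finset.sum_le_sum fun r hr =>
    sum_lowFrequencies_le_sum_discrepancy (L := L) (Finset.mem_Ico.1 hr).2 (by omega) x)
  rw [Finset.sum_comm]
  refine (mul_le_mul_of_nonneg_left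
    (card_dyadicShapes_le (2 * H) (fun n i => ⌊((2 * H : ℕ) : ℝ) * x n i⌋) hL1 hL2)
    (by positivity)).trans ?_
  rw [Finset.mul_sum]
  refine Finset.sum_le_sum fun k hk => ?_
  have havg := le_sum_prod_norm_one_sub_unitExp (H := H) (fun i => max 1 (k i).natAbs)
    (fun i => lt_max_of_lt_left one_pos) (fun i => by
      have h1 := abs_lt_of_mem_lowFrequencies hk i
      have h2 : max 1 (k i).natAbs ≤ 4 * N := by omega
      calc 2 * d * max 1 (k i).natAbs ≤ 2 * d * (4 * N) := by gcongr
        _ = 8 * (d * N) := by ring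
        _ < H := by omega)
  -- The radius `0` contributes nothing, so it may be left out of the average.
  rw [Finset.range_eq_Ico, Finset.sum_eq_sum_Ico_succ_bot hHpos] at havg
  have hzero : ∏ i : Fin d, ‖1 - unitExp ((max 1 (k i).natAbs : ℕ) * (0 : ℕ) / H)‖ ^ 2 = 0 :=
    Finset.prod_eq_zero (Finset.mem_univ ⟨0, hd⟩) (by simp [unitExp_zero])
  rw [hzero, zero_add, zero_add] at havg
  rw [← Finset.mul_sum, ← Finset.mul_sum]
  calc _ = ‖pointSum (2 * H) (fun n i => ⌊((2 * H : ℕ) : ℝ) * x n i⌋) k‖ ^ 2 *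
          ((H / Real.pi) ^ (2 * d) * (∏ i, (1 / ((max 1 (k i).natAbs : ℕ) : ℝ) ^ 2)) *
            (H / ((2 * d + 1) * (4 * (2 * d + 1) ^ 2) ^ d))) := by ring
    _ ≤ _ := by gcongr

theorem theorem2 (d : ℕ) (hd : 1 ≤ d) :
    ∃ c : ℝ, 0 < c ∧ ∀ N : ℕ, 1 ≤ N → ∀ M : ℕ, Even M → 18 * d * N ≤ M →
      ∀ p : Fin N → Torus d,
        c * (Real.log (N : ℝ)) ^ (((d : ℝ) - 1) / 2) ≤
          Real.sqrt
            (1 / ((gridIndices M).card : ℝ) ^ d * (1 / ((gridRadii M).card : ℝ)) *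
              ∑ j ∈ Fintype.piFinset (fun _ : Fin d => gridIndices M), ∑ s ∈ gridRadii M,
                |discrepancy
                  (translatedCube (Torus.proj (fun i => (j i : ℝ) / (M : ℝ))) s) p| ^ 2) := by
  obtain ⟨m, rfl⟩ : ∃ m, d = m + 1 := ⟨d - 1, by omega⟩
  set d := m + 1 with hdm
  set C : ℝ := 1 / (4 * Real.pi ^ 2) ^ d * (1 / ((2 * d + 1) * (4 * (2 * d + 1) ^ 2) ^ d)) *
    ((3 / 4 : ℝ) ^ d / 8) * (1 / (d : ℝ) ^ m) with hC
  have hdpos : (0 : ℝ) < d := by exact_mod_cast hd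
  have hCpos : 0 < C := by positivity
  refine ⟨Real.sqrt C, Real.sqrt_pos.2 hCpos, ?_⟩
  intro N hN M hM hMN p
  obtain ⟨H, hH⟩ := hM
  obtain rfl : M = 2 * H := by omega
  choose x hx using fun n => exists_proj_eq (p n)
  obtain rfl : (fun n => Torus.proj (x n)) = p := funext hx
  have hdN : 1 * N ≤ d * N := by gcongr
  have hHN : 9 * d * N ≤ H := by linarith
  have hHN' : 9 * (d * N) ≤ H := by linarith
  have hHpos : (0 : ℝ) < H := by
    have : 0 < H := by omega
    exact_mod_cast this
  -- The scale `2 ^ L` is the power of two with `2 * N < 2 ^ L ≤ 4 * N`.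
  set L := Nat.log 2 (4 * N) with hL
  have hL2 : 2 ^ L ≤ 4 * N := Nat.pow_log_le_self 2 (by omega)
  have hL1 : 2 * N ≤ 2 ^ L := by
    have := Nat.lt_pow_succ_log_self (b := 2) (by norm_num) (4 * N)
    rw [← hL, pow_succ] at this
    omega
  have hNR : (1 : ℝ) ≤ N := by exact_mod_cast hN
  have hlog0 : 0 ≤ Real.log N := Real.log_nonneg hNR
  have hlogL : Real.log N ≤ L := by
    have h1 : (N : ℝ) ≤ 2 ^ L := by
      have : N ≤ 2 ^ L := by omega
      exact_mod_cast this
    calc Real.log N ≤ Real.log (2 ^ L) := Real.log_le_log (by linarith) h1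
      _ = L * Real.log 2 := Real.log_pow _ _
      _ ≤ L * 1 := by
          gcongr
          linarith [Real.log_two_lt_d9]
      _ = L := mul_one _
  have hcard : Real.log N ^ m * (1 / (d : ℝ) ^ m) ≤ (dyadicShapes d L).card := by
    have h1 : Real.log N / d ≤ ((L / d + 1 : ℕ) : ℝ) := by
      rw [div_le_iff₀ hdpos]
      refine hlogL.trans ?_
      have : L ≤ (L / d + 1) * d := by
        have h3 := Nat.lt_div_mul_add (a := L) (b := d) (by omega)
        linarith
      exact_mod_cast this
    calc Real.log N ^ m * (1 / (d : ℝ) ^ m) = (Real.log N / d) ^ m := by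
          rw [div_pow]
          ring
      _ ≤ ((L / d + 1 : ℕ) : ℝ) ^ m := by gcongr
      _ ≤ _ := by exact_mod_cast pow_le_card_dyadicShapes m L
  have hmain := card_dyadicShapes_le_sum_discrepancy hd hN hHN hL1 hL2 x
  have hinj := injective_div_natCast (H := H) (by omega)
  rw [card_gridIndices, gridRadii_eq_image, Finset.card_image_of_injective _ hinj, Nat.card_Ico]
  simp_rw [Finset.sum_image (fun a _ b _ h => hinj h)]
  rw [Finset.sum_comm]
  set X := ∑ r ∈ Finset.Ico 1 H,
    ∑ j ∈ Fintype.piFinset (fun _ : Fin d => gridIndices (2 * H)),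
      |discrepancy (translatedCube (Torus.proj (fun i => (j i : ℝ) / (2 * H : ℕ)))
        ((r : ℝ) / (2 * H : ℕ))) (fun n => Torus.proj (x n))| ^ 2 with hX
  have hX0 : 0 ≤ X := by positivity
  refine Real.le_sqrt_of_sq_le ?_
  have hpow : (Real.log N ^ (((d : ℝ) - 1) / 2)) ^ 2 = Real.log N ^ m := by
    rw [← Real.rpow_natCast, ← Real.rpow_mul hlog0, ← Real.rpow_natCast]
    congr 1
    rw [hdm]
    push_cast
    ring
  rw [mul_pow, Real.sq_sqrt hCpos.le, hpow]
  have hH1 : (0 : ℝ) < ((H - 1 : ℕ) : ℝ) := by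
    have : 0 < H - 1 := by omega
    exact_mod_cast this
  have hH2 : ((H - 1 : ℕ) : ℝ) ≤ H := by exact_mod_cast Nat.sub_le H 1
  have hpi := Real.pi_pos
  set K : ℝ := (1 / ((2 * d + 1) * (4 * (2 * d + 1) ^ 2) ^ d)) * ((3 / 4 : ℝ) ^ d / 8) with hK
  have hK0 : 0 < K := by positivity
  calc C * Real.log N ^ m
      = 1 / (4 * Real.pi ^ 2) ^ d * K * (Real.log N ^ m * (1 / (d : ℝ) ^ m)) := by
        rw [hC, hK]
        ring
    _ ≤ 1 / (4 * Real.pi ^ 2) ^ d * K * (dyadicShapes d L).card := by gcongr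
    _ = 1 / ((2 * H : ℕ) : ℝ) ^ d * (1 / H) * (1 / ((2 * H : ℕ) : ℝ) ^ d *
          ((H / Real.pi) ^ (2 * d) * (H / ((2 * d + 1) * (4 * (2 * d + 1) ^ 2) ^ d)) *
            ((3 / 4 : ℝ) ^ d / 8 * (dyadicShapes d L).card))) := by
        have e : 1 / (4 * Real.pi ^ 2) ^ d = 1 / ((2 * H : ℕ) : ℝ) ^ d *
            (1 / ((2 * H : ℕ) : ℝ) ^ d) * (H / Real.pi) ^ (2 * d) := by
          rw [pow_mul, ← one_div_pow, ← one_div_pow, ← mul_pow, ← mul_pow]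
          congr 1
          push_cast
          field_simp
          norm_num
        rw [e, hK]
        field_simp
    _ ≤ 1 / ((2 * H : ℕ) : ℝ) ^ d * (1 / H) * (1 / ((2 * H : ℕ) : ℝ) ^ d *
          (((2 * H : ℕ) : ℝ) ^ d * X)) := by gcongr
    _ = 1 / ((2 * H : ℕ) : ℝ) ^ d * (1 / H) * X := by
        have : ((2 * H : ℕ) : ℝ) ^ d ≠ 0 := by
          push_cast
          positivity
        rw [← mul_assoc (1 / ((2 * H : ℕ) : ℝ) ^ d) _ X, one_div_mul_cancel this, one_mul]
    _ ≤ 1 / ((2 * H : ℕ) : ℝ) ^ d * (1 / ((H - 1 : ℕ) : ℝ)) * X := by gcongr
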